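/- \textbf{Theorem.} There is an absolute constant $c>1$ and an efficient (i.e. polylogarithmic-depth) decision-tree reduction from $\textsc{Refuter}(s(\mathrm{PHP}_{(n+1)\to n}\vdash_{\mathsf{Res}}\bot)\le c^n)$ to $\mathrm{rwPHP}(\mathsf{PLS})$. Explicitly: there are $c>1$ and $k\in\mathbb N$ such that for every $n\ge 1$, if $N$ denotes the bit-length of the inputs of the refuter problem for $n$, then for some $d\le(\log N+2)^k$ there is a depth-$d$ decision-tree reduction from this refuter problem to $\mathrm{rwPHP}(\mathsf{PLS})$ for some choice of its parameters. The notions are as follows (with $[m]=\{0,\dots,m-1\}$). \begin{itemize} \item \emph{Pigeonhole principle.} $\mathrm{PHP}_{m\to n}$ is the CNF in variables $x_{ij}$ ($i\in[m]$, $j\in[n]$) with the clauses $\bigvee_{j}x_{ij}$ for all $i$, and $\overline{x}_{ij}\vee\overline{x}_{i'j}$ for all $i<i'$ and all $j$. \item \emph{Refuter problem.} The input is a purported resolution refutation $C_0,\dots,C_{\ell-1}$ of $\mathrm{PHP}_{(n+1)\to n}$ of some length $1\le \ell\le c^n$. Each node $C_i$ consists of a clause (a set of literals) and either the tag ``resolution'',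 a variable $a$ and two predecessors, or the tag ``weakening'' and one predecessor; predecessors are axioms or earlier nodes. A node $C_i$ is valid if $C_j=a\vee D$, $C_k=\overline a\vee E$, $C_i=D\vee E$ for some clauses $D,E$ (resolution of $C_j,C_k$ on $a$), respectively $C_i=C_j\vee D$ for some clause $D$ (weakening of $C_j$), and moreover $C_i$ is empty if $i=\ell-1$. A solution is an index $i<\ell$ of an invalid node. \item \emph{$\mathrm{rwPHP}(\mathsf{PLS})$.} For parameters $M,N',L\ge 1$ with $2M\le N'$, the input consists of functions $f:[M]\to[N']$, $S_y:[L]\to[L]$ and $g_y:[L]\to[M]$ for $y\in[N']$. A solution is a pair $(y,a)\in[N']\times[L]$ such that $f(g_y(a))\ne y$ and $a$ is a solution of the $\textsc{Iter}$ instance $S_y$, which means that $a=0$ and $S_y(0)=0$, or $S_y(a)<a$, or $S_y(a)>a$ and $S_y(S_y(a))=S_y(a)$. \item \emph{Reductions.} A depth-$d$ decision-tree reduction from a search problem $\mathcal P$ to a search problem $\mathcal Q$ consists of a map $F$ from inputs of $\mathcal P$ to inputs of $\mathcal Q$, which have bit-length at most $2^d$, and a map $G$ that takes an input $x$ of $\mathcal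 P$ and any solution of $F(x)$ to a solution of $x$; every entry of $F(x)$, and $G(x,o)$ for every fixed $o$, is computed by a decision tree that queries at most $d$ bits of $x$. \end{itemize} -/

import Mathlib

/-! ### Search problems and decision trees -/

/-- A (size-`N`) search problem in the query model. An input assigns to each block `b` a value in
the finite alphabet `Val b`; `IsSol x o` says that `o` is a solution of the input `x`. -/
structure SearchProblem where
  Block : Type
  [blockFintype : Fintype Block]
  Val : Block → Type
  [valFinite : ∀ b, Finite (Val b)]
  Sol : Type
  [solFinite : Finite Sol]
  IsSol : (∀ b, Val b) → Sol → Prop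

attribute [instance] SearchProblem.blockFintype SearchProblem.valFinite SearchProblem.solFinite

namespace SearchProblem

/-- Inputs of a search problem. -/
abbrev Input (P : SearchProblem) : Type := ∀ b, P.Val b

/-- The number of bits that encode the content of the block `b`. -/
noncomputable def blockBits (P : SearchProblem) (b : P.Block) : ℕ :=
  Nat.clog 2 (Nat.card (P.Val b))

/-- The bit-length of an input. -/
noncomputable def size (P : SearchProblem) : ℕ := ∑ b, P.blockBits b

end SearchProblem

/-- Decision trees over the inputs of `P`, with leaves labelled by elements of `β`. -/
inductive DecisionTree (P : SearchProblem) (β : Type) : Type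
  | leaf (r : β) : DecisionTree P β
  | query (b : P.Block) (next : P.Val b → DecisionTree P β) : DecisionTree P β

namespace DecisionTree

/-- The output of a decision tree on the input `x`. -/
def eval {P : SearchProblem} {β : Type} (x : P.Input) : DecisionTree P β → β
  | leaf r => r
  | query b next => eval x (next (x b))

/-- The number of bits that a decision tree reads on the input `x`; querying a block reads all
bits of the block. -/
noncomputable def cost {P : SearchProblem} {β : Type} (x : P.Input) : DecisionTree P β → ℕ
  | leaf _ => 0
  | query b next => P.blockBits b + cost x (next (x b))

/-- `T` has (bit-)depth at most `d`. -/
def DepthLE {P : SearchProblem} {β : Type} (T : DecisionTree P β) (d : ℕ) : Prop :=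
  ∀ x : P.Input, T.cost x ≤ d

end DecisionTree

/-- A depth-`d` (many-one) decision tree reduction from `P` to `Q`. -/
structure DTReduction (P Q : SearchProblem) (d : ℕ) where
  /-- computes the blocks of the instance of `Q` -/
  inst : ∀ b : Q.Block, DecisionTree P (Q.Val b)
  /-- maps solutions of the instance of `Q` to solutions of the given instance of `P` -/
  sol : Q.Sol → DecisionTree P P.Sol
  inst_depth : ∀ b, (inst b).DepthLE d
  sol_depth : ∀ o, (sol o).DepthLE d
  size_le : Q.size ≤ 2 ^ d
  correct : ∀ (x : P.Input) (o : Q.Sol),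
    Q.IsSol (fun b => (inst b).eval x) o → P.IsSol x ((sol o).eval x)

/-- The family `P` reduces to the family `Q` by decision tree reductions of polylogarithmic depth:
for a fixed exponent `k`, each `P i` has a reduction of depth at most `(log N + 2) ^ k` to some
`Q j`, where `N` is the bit-length of the inputs of `P i`. -/
def EfficientlyReducible {ι κ : Type} (P : ι → SearchProblem) (Q : κ → SearchProblem) : Prop :=
  ∃ k : ℕ, ∀ i : ι, ∃ j : κ, ∃ d : ℕ,
    d ≤ (Nat.log 2 (P i).size + 2) ^ k ∧ Nonempty (DTReduction (P i) (Q j) d)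

/-! ### The problems `Iter` and `rwPHP(PLS)` -/

/-- `Iter`: the input is a function `S : [L] → [L]`. -/
def Iter (L : ℕ) : SearchProblem where
  Block := Fin L
  Val := fun _ => Fin L
  Sol := Fin L
  IsSol := fun S x =>
    ((x : ℕ) = 0 ∧ S x = x) ∨ S x < x ∨ (x < S x ∧ S (S x) = S x)

/-- Blocks of `rwPHP(P)`: the entries `f(x)`, the blocks of the instances `I_y`, and the entries
`g_y(ans)`. -/
abbrev RwPHPBlock (P : SearchProblem) (M N : ℕ) : Type :=
  Fin M ⊕ (Fin N × P.Block) ⊕ (Fin N × P.Sol)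

/-- The alphabets of the blocks of `rwPHP(P)`. -/
abbrev RwPHPVal (P : SearchProblem) (M N : ℕ) : RwPHPBlock P M N → Type
  | .inl _ => Fin N
  | .inr (.inl (_, b)) => P.Val b
  | .inr (.inr _) => Fin M

instance (P : SearchProblem) (M N : ℕ) : ∀ b, Finite (RwPHPVal P M N b)
  | .inl _ => inferInstanceAs (Finite (Fin N))
  | .inr (.inl (_, b)) => inferInstanceAs (Finite (P.Val b))
  | .inr (.inr _) => inferInstanceAs (Finite (Fin M))

/-- `rwPHP(P)` with `f : [M] → [N]`, instances `I_y` of `P` for `y ∈ [N]`, and maps `g_y` from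
the possible solutions of `I_y` to `[M]`. A solution is a pair `(y, ans)` such that `ans` is a
solution of `I_y` and `f (g_y ans) ≠ y`. -/
noncomputable def rwPHP (P : SearchProblem) (M N : ℕ) : SearchProblem where
  Block := RwPHPBlock P M N
  blockFintype :=
    haveI : Fintype P.Sol := Fintype.ofFinite P.Sol
    inferInstanceAs (Fintype (Fin M ⊕ (Fin N × P.Block) ⊕ (Fin N × P.Sol)))
  Val := RwPHPVal P M N
  Sol := Fin N × P.Sol
  IsSol := fun x s =>
    let f : Fin M → Fin N := fun u => x (.inl u)
    let I : Fin N → P.Input := fun y b => x (.inr (.inl (y, b)))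
    let g : Fin N → P.Sol → Fin M := fun y a => x (.inr (.inr (y, a)))
    P.IsSol (I s.1) s.2 ∧ f (g s.1 s.2) ≠ s.1

/-- Parameters of `rwPHP(PLS)`. -/
structure RwPHPPLSParams where
  M : ℕ
  N : ℕ
  L : ℕ
  M_pos : 1 ≤ M
  two_mul_M_le : 2 * M ≤ N
  L_pos : 1 ≤ L

/-- The problem `rwPHP(PLS)`. -/
noncomputable def rwPHPPLS (p : RwPHPPLSParams) : SearchProblem := rwPHP (Iter p.L) p.M p.N

/-! ### Resolution and its refuter problem -/

/-- Clauses are sets of literals; `(v, true)` is the literal `v` and `(v, false)` its negation. -/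
abbrev Clause (V : Type) : Type := Finset (V × Bool)

/-- A CNF over the variables `V` with clauses (axioms) indexed by `A`. -/
abbrev CNF (V A : Type) : Type := A → Clause V

/-- The possible predecessors of the `i`-th node: the axioms and the earlier nodes. -/
abbrev NodeRef (A : Type) (i : ℕ) : Type := A ⊕ Fin i

/-- The content of the `i`-th node of a purported refutation: a clause, together with either
(tag "resolution") a variable and two predecessors or (tag "weakening") one predecessor. -/
abbrev ResNode (V A : Type) (i : ℕ) : Type :=
  Clause V × ((V × NodeRef A i × NodeRef A i) ⊕ NodeRef A i)

/-- The clause written at a predecessor. -/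
def refClause {V A : Type} (F : CNF V A) {s : ℕ} (nodes : ∀ i : Fin s, ResNode V A i)
    (i : Fin s) : NodeRef A i → Clause V
  | .inl a => F a
  | .inr j => (nodes ⟨j, j.isLt.trans i.isLt⟩).1

/-- The `i`-th node is obtained by a legal application of its rule. -/
def LegalStep {V A : Type} [DecidableEq V] (F : CNF V A) {s : ℕ}
    (nodes : ∀ i : Fin s, ResNode V A i) (i : Fin s) : Prop :=
  match (nodes i).2 with
  | .inl (a, j, k) => ∃ D E : Clause V,
      refClause F nodes i j = {(a, true)} ∪ D ∧
      refClause F nodes i k = {(a, false)} ∪ E ∧ (nodes i).1 = D ∪ E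
  | .inr j => ∃ D : Clause V, (nodes i).1 = refClause F nodes i j ∪ D

/-- The `i`-th node of the purported refutation of length `len` is valid: its step is legal, and
its clause is empty if it is the last node. -/
def ValidNode {V A : Type} [DecidableEq V] (F : CNF V A) {s : ℕ} (len : ℕ)
    (nodes : ∀ i : Fin s, ResNode V A i) (i : Fin s) : Prop :=
  LegalStep F nodes i ∧ ((i : ℕ) + 1 = len → (nodes i).1 = ∅)

/-- The alphabets of the blocks of the refuter problem. The block `none` contains the length of
the refutation (the value `l` stands for length `l + 1`), the block `some i` the `i`-th node. -/
abbrev RefuterVal (V A : Type) (s : ℕ) : Option (Fin s) → Type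
  | none => Fin s
  | some i => ResNode V A i

instance (V A : Type) [Finite V] [Finite A] (s : ℕ) : ∀ b, Finite (RefuterVal V A s b)
  | none => inferInstanceAs (Finite (Fin s))
  | some i => inferInstanceAs (Finite (ResNode V A i))

/-- `Refuter(s(F ⊢_Res ⊥) ≤ s)`: the input is a purported resolution refutation of `F` with at
least one and at most `s` nodes (only the first `len` node blocks belong to it); a solution is
the index of an invalid node of it. -/
def Refuter {V A : Type} [DecidableEq V] [Finite V] [Finite A] (F : CNF V A) (s : ℕ) :
    SearchProblem where
  Block := Option (Fin s)
  Val := RefuterVal V A s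
  Sol := Fin s
  IsSol := fun x i =>
    let last : Fin s := x none
    let nodes : ∀ i : Fin s, ResNode V A i := fun i => x (some i)
    i ≤ last ∧ ¬ ValidNode F ((last : ℕ) + 1) nodes i

/-! ### The pigeonhole principle -/

/-- Indices of the clauses of `PHP_{m → n}`: one for each pigeon, and one for each pair of
different pigeons and each hole. -/
abbrev PHPAxiom (m n : ℕ) : Type :=
  Fin m ⊕ ({p : Fin m × Fin m // p.1 < p.2} × Fin n)

/-- `PHP_{m → n}`; the variable `(i, j)` says that pigeon `i` goes to hole `j`. -/
def PHP (m n : ℕ) : CNF (Fin m × Fin n) (PHPAxiom m n)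
  | .inl i => Finset.univ.image fun j : Fin n => ((i, j), true)
  | .inr (p, j) => {((p.1.1, j), false), ((p.1.2, j), false)}

/-! The reduction makes a random-restriction width lower bound constructive. Put K = n / 6 and let y
range over the ordered partial matchings l with t = n + 1 - 3K edges, so that 3K pigeons stay free.
Measure a clause C by the number of pigeons left out by some critical assignment that extends l and
falsifies C (`witnesses`). The empty clause has measure 3K, axioms have measure at most 1,
resolution is subadditive and weakening does not increase the measure. Hence a legal node of measure
above 2K ("large") has a predecessor of measure above K.

For each y, the `Iter` instance starts at the last node and keeps moving to such a predecessor;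
positions count backwards from the last node. The walk must get stuck either at an invalid node,
which is what is sought, or just before a "medium" node, of measure in (K, 2K]. In the latter case
g_y returns that node together with the rank of y among the matchings for which its clause is
medium. From this f recovers y, so the pair is no solution of rwPHP(PLS). This is
`refuter_reduction`.

It remains to see that f has a small domain. A medium clause has at least 2K^2 monotone edges among
the free edges (`card_witnesses_mul_le`), all avoided by l. So at each of the t choices at least a
1/66 fraction of the edges was forbidden (`card_avoiding_matchings_le`), and a clause is medium for
at most a (65/66)^t fraction of the matchings. As t is at least n / 2, this beats 2 c^n for c close
to 1. -/

namespace DecisionTree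

/-! ### Tools: relabelled trees and encodings. -/

variable {P : SearchProblem} {β γ : Type}

/-- Relabel the leaves of a decision tree. -/
def map (f : β → γ) : DecisionTree P β → DecisionTree P γ
  | leaf r => leaf (f r)
  | query b next => query b fun v => map f (next v)

theorem eval_map (f : β → γ) (T : DecisionTree P β) (x : P.Input) :
    (T.map f).eval x = f (T.eval x) := by
  induction T with
  | leaf r => rfl
  | query b next ih => exact ih _

theorem cost_map (f : β → γ) (T : DecisionTree P β) (x : P.Input) :
    (T.map f).cost x = T.cost x := by
  induction T with
  | leaf r => rfl
  | query b next ih => simp only [map, cost, ih]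

end DecisionTree

/-- A set of at most `b` elements can be encoded by, and decoded from, numbers below `b`. -/
theorem exists_encoding {Y : Type} [Fintype Y] [Nonempty Y] {b : ℕ} (hb : 0 < b) (p : Y → Prop)
    [DecidablePred p] (h : (Finset.univ.filter p).card ≤ b) :
    ∃ (enc : Y → Fin b) (dec : Fin b → Y), ∀ y, p y → dec (enc y) = y := by
  classical
  have : Nonempty ({y // p y} ↪ Fin b) := by
    apply Function.Embedding.nonempty_of_card_le
    simpa [Fintype.card_subtype] using h
  obtain ⟨e⟩ := this
  refine ⟨fun y => if hy : p y then e ⟨y, hy⟩ else ⟨0, hb⟩,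
    fun t => if ht : ∃ z, e z = t then ht.choose.1 else Classical.arbitrary Y, fun y hy => ?_⟩
  have hex : ∃ z, e z = e ⟨y, hy⟩ := ⟨_, rfl⟩
  simp only [hy, dif_pos, hex]
  exact congrArg Subtype.val (e.injective hex.choose_spec)

/-! ### Measures of clauses along one inference. -/

section Predecessors

variable {V A : Type}

/-- The predecessors of a node; the only predecessor of a weakening is counted twice. -/
def nodePreds {i : ℕ} (nd : ResNode V A i) : NodeRef A i × NodeRef A i :=
  match nd.2 with
  | .inl (_, j, k) => (j, k)
  | .inr j => (j, j)

/-- The node at a predecessor, if it is not an axiom. -/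
def refIndex {s : ℕ} (i : Fin s) : NodeRef A i → Option (Fin s)
  | .inl _ => none
  | .inr j => some ⟨j, j.isLt.trans i.isLt⟩

/-- A predecessor of measure more than `K`, together with its clause. -/
def choosePred {s : ℕ} (φ : Clause V → ℕ) (K : ℕ) (i : Fin s)
    (r₁ r₂ : NodeRef A i) (C₁ C₂ : Clause V) : Option (Fin s × Clause V) :=
  if K < φ C₁ then (refIndex i r₁).map (·, C₁)
  else if K < φ C₂ then (refIndex i r₂).map (·, C₂)
  else none

/-- A chosen predecessor is an earlier node, and is not small. -/
theorem choosePred_spec (F : CNF V A) {s : ℕ} {φ : Clause V → ℕ} {K : ℕ}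
    (nodes : ∀ i : Fin s, ResNode V A i) (i : Fin s)
    (q : Fin s × Clause V)
    (h : choosePred φ K i (nodePreds (nodes i)).1 (nodePreds (nodes i)).2
      (refClause F nodes i (nodePreds (nodes i)).1)
      (refClause F nodes i (nodePreds (nodes i)).2) = some q) :
    q.1 < i ∧ q.2 = (nodes q.1).1 ∧ K < φ q.2 := by
  have key : ∀ r : NodeRef A i, K < φ (refClause F nodes i r) →
      (refIndex i r).map (·, refClause F nodes i r) = some q →
      q.1 < i ∧ q.2 = (nodes q.1).1 ∧ K < φ q.2 := by
    intro r hr hq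
    cases r with
    | inl a => simp [refIndex] at hq
    | inr j =>
      simp only [refIndex, Option.map_some, Option.some.injEq] at hq
      subst hq
      exact ⟨j.isLt, rfl, hr⟩
  unfold choosePred at h
  split_ifs at h with h1 h2
  · exact key _ h1 h
  · exact key _ h2 h

/-- A large node without a suitable predecessor is not legal. -/
theorem not_legalStep_of_choosePred_eq_none [DecidableEq V] (F : CNF V A) {s : ℕ} {φ : Clause V → ℕ} {K : ℕ}
    (hax : ∀ a, φ (F a) ≤ K)
    (hres : ∀ v D E, φ (D ∪ E) ≤ φ ({(v, true)} ∪ D) + φ ({(v, false)} ∪ E))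
    (hweak : ∀ C D, φ (C ∪ D) ≤ φ C)
    (nodes : ∀ i : Fin s, ResNode V A i) (i : Fin s) (hl : 2 * K < φ (nodes i).1)
    (h : choosePred φ K i (nodePreds (nodes i)).1 (nodePreds (nodes i)).2
      (refClause F nodes i (nodePreds (nodes i)).1)
      (refClause F nodes i (nodePreds (nodes i)).2) = none) :
    ¬ LegalStep F nodes i := by
  have key : ∀ r : NodeRef A i, K < φ (refClause F nodes i r) →
      (refIndex i r).map (·, refClause F nodes i r) ≠ none := by
    intro r hr
    cases r with
    | inl a => exact absurd hr (not_lt.2 (hax a))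
    | inr j => simp [refIndex]
  -- Axioms have measure at most K, so a predecessor above K is always a node and would be chosen.
  -- Thus both predecessors are small, and legality would bound the measure by 2 * K.
  have hsmall : φ (refClause F nodes i (nodePreds (nodes i)).1) ≤ K ∧
      φ (refClause F nodes i (nodePreds (nodes i)).2) ≤ K := by
    unfold choosePred at h
    split_ifs at h with h1 h2
    · exact absurd h (key _ h1)
    · exact absurd h (key _ h2)
    · exact ⟨not_lt.1 h1, not_lt.1 h2⟩
  obtain ⟨s1, s2⟩ := hsmall
  intro hleg
  unfold LegalStep at hleg
  unfold nodePreds at s1 s2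
  rcases hnd : (nodes i).2 with ⟨v, j, k⟩ | j
  · rw [hnd] at hleg s1 s2
    obtain ⟨D, E, hj, hk, hC⟩ := hleg
    have := hres v D E
    rw [hj] at s1
    rw [hk] at s2
    rw [hC] at hl
    omega
  · rw [hnd] at hleg s1 s2
    obtain ⟨D, hC⟩ := hleg
    have := hweak (refClause F nodes i j) D
    simp only at s1
    rw [hC] at hl
    omega

end Predecessors

/-- The truncated difference of two indices. -/
def indexSub {s : ℕ} (last a : Fin s) : Fin s :=
  ⟨last - a, (Nat.sub_le _ _).trans_lt last.isLt⟩

/-! ### The local search and the abstract reduction. -/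

section Search

variable {V A : Type} [DecidableEq V] [Finite V] [Finite A]

/-- Read the clause at a predecessor, and continue with it. -/
def readRef (F : CNF V A) {s : ℕ} {β : Type} (i : Fin s) (r : NodeRef A i)
    (next : Clause V → DecisionTree (Refuter F s) β) : DecisionTree (Refuter F s) β :=
  match r with
  | .inl a => next (F a)
  | .inr j => .query (P := Refuter F s) (some ⟨j, j.isLt.trans i.isLt⟩)
      fun nd : ResNode V A j => next nd.1

theorem eval_readRef (F : CNF V A) {s : ℕ} {β : Type} (i : Fin s) (r : NodeRef A i)
    (next : Clause V → DecisionTree (Refuter F s) β) (x : (Refuter F s).Input) :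
    (readRef F i r next).eval x
      = (next (refClause F (fun i : Fin s => (x (some i) : ResNode V A i)) i r)).eval x := by
  cases r <;> rfl

theorem cost_readRef_le (F : CNF V A) {s : ℕ} {β : Type} (i : Fin s) (r : NodeRef A i)
    (next : Clause V → DecisionTree (Refuter F s) β) (x : (Refuter F s).Input) {B c : ℕ}
    (hB : ∀ b, (Refuter F s).blockBits b ≤ B) (h : ∀ C, (next C).cost x ≤ c) :
    (readRef F i r next).cost x ≤ B + c := by
  cases r with
  | inl a => exact (h _).trans (Nat.le_add_left _ _)
  | inr j => exact Nat.add_le_add (hB _) (h _)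

/-- The nodes of an input of the refuter problem. -/
def refuterNodes {F : CNF V A} {s : ℕ} (x : (Refuter F s).Input) (i : Fin s) : ResNode V A i :=
  x (some i)

/-- The step of the local search at the node `i`: `none` if the node is not large, and
otherwise a predecessor that is not small, if there is one. -/
def nodeStep (F : CNF V A) {s : ℕ} (φ : Clause V → ℕ) (K : ℕ) (i : Fin s) :
    DecisionTree (Refuter F s) (Option (Option (Fin s × Clause V))) :=
  .query (P := Refuter F s) (some i) fun nd : ResNode V A i =>
    if 2 * K < φ nd.1 then
      readRef F i (nodePreds nd).1 fun C₁ => readRef F i (nodePreds nd).2 fun C₂ =>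
        .leaf (some (choosePred φ K i (nodePreds nd).1 (nodePreds nd).2 C₁ C₂))
    else .leaf none

/-- The step of the local search at the node `last - a`, together with the index `last`. -/
def searchStep (F : CNF V A) {s : ℕ} (φ : Clause V → ℕ) (K : ℕ) (a : Fin s) :
    DecisionTree (Refuter F s) (Fin s × Option (Option (Fin s × Clause V))) :=
  .query (P := Refuter F s) none fun last : Fin s =>
    if a ≤ last then (nodeStep F φ K (indexSub last a)).map fun o => (last, o)
    else .leaf (last, none)

theorem cost_nodeStep_le (F : CNF V A) {s : ℕ} (φ : Clause V → ℕ) (K : ℕ) (i : Fin s)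
    (x : (Refuter F s).Input) {B : ℕ} (hB : ∀ b, (Refuter F s).blockBits b ≤ B) :
    (nodeStep F φ K i).cost x ≤ 3 * B := by
  have h1 := hB (some i)
  unfold nodeStep
  simp only [DecisionTree.cost]
  split_ifs
  · have := cost_readRef_le F i (nodePreds (refuterNodes x i)).1
      (fun C₁ => readRef F i (nodePreds (refuterNodes x i)).2 fun C₂ =>
        .leaf (some (choosePred φ K i (nodePreds (refuterNodes x i)).1
          (nodePreds (refuterNodes x i)).2 C₁ C₂))) x hB
      (fun C => cost_readRef_le F i _ _ x hB (c := 0) fun _ => le_rfl)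
    exact (Nat.add_le_add h1 this).trans (by omega)
  · simp only [DecisionTree.cost]
    omega

/-- At most four blocks are read: the length, the node and its two predecessors. -/
theorem cost_searchStep_le (F : CNF V A) {s : ℕ} (φ : Clause V → ℕ) (K : ℕ) (a : Fin s)
    (x : (Refuter F s).Input) {B : ℕ} (hB : ∀ b, (Refuter F s).blockBits b ≤ B) :
    (searchStep F φ K a).cost x ≤ 4 * B := by
  have h0 := hB none
  unfold searchStep
  simp only [DecisionTree.cost]
  split_ifs with h
  · rw [DecisionTree.cost_map]
    have := cost_nodeStep_le F φ K (indexSub (x none) a) x hB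
    omega
  · simp only [DecisionTree.cost]
    omega

theorem eval_nodeStep (F : CNF V A) {s : ℕ} (φ : Clause V → ℕ) (K : ℕ) (i : Fin s)
    (x : (Refuter F s).Input) :
    (nodeStep F φ K i).eval x =
      if 2 * K < φ (refuterNodes x i).1 then
        some (choosePred φ K i (nodePreds (refuterNodes x i)).1 (nodePreds (refuterNodes x i)).2
          (refClause F (refuterNodes x) i (nodePreds (refuterNodes x i)).1)
          (refClause F (refuterNodes x) i (nodePreds (refuterNodes x i)).2))
      else none := by
  change DecisionTree.eval x (if 2 * K < φ (refuterNodes x i).1 then _ else _) = _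
  split_ifs with h
  · rw [eval_readRef, eval_readRef]
    rfl
  · rfl

theorem eval_searchStep (F : CNF V A) {s : ℕ} (φ : Clause V → ℕ) (K : ℕ) (a : Fin s)
    (x : (Refuter F s).Input) :
    (searchStep F φ K a).eval x =
      ((x none : Fin s), if a ≤ (x none : Fin s)
        then (nodeStep F φ K (indexSub (x none) a)).eval x else none) := by
  change DecisionTree.eval x (if a ≤ (x none : Fin s) then _ else _) = _
  split_ifs with h
  · rw [DecisionTree.eval_map]
    rfl
  · rfl

/-- If the clauses carry measures `φ y` with the properties that are used in a width lower bound,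
and each clause is of medium measure for few of the `y` only, then the refuter problem reduces to
`rwPHP(PLS)`. -/
theorem refuter_reduction (F : CNF V A) {s K N b B d : ℕ} (hs : 0 < s) (hb : 0 < b)
    (hN : 2 * (s * b) ≤ N) (φ : Fin N → Clause V → ℕ)
    (hempty : ∀ y, 2 * K < φ y ∅) (hax : ∀ y a, φ y (F a) ≤ K)
    (hres : ∀ y v D E, φ y (D ∪ E) ≤ φ y ({(v, true)} ∪ D) + φ y ({(v, false)} ∪ E))
    (hweak : ∀ y C D, φ y (C ∪ D) ≤ φ y C)
    (hcard : ∀ C, (Finset.univ.filter fun y => K < φ y C ∧ φ y C ≤ 2 * K).card ≤ b)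
    (hB : ∀ b, (Refuter F s).blockBits b ≤ B) (hd : 4 * B ≤ d)
    (hsize : (rwPHP (Iter s) (s * b) N).size ≤ 2 ^ d) :
    Nonempty (DTReduction (Refuter F s)
      (rwPHPPLS ⟨s * b, N, s, Nat.mul_pos hs hb, hN, hs⟩) d) := by
  classical
  have hNpos : 0 < N := lt_of_lt_of_le (by positivity) hN
  have : Nonempty (Fin N) := ⟨⟨0, hNpos⟩⟩
  choose enc dec hdec using fun C =>
    exists_encoding hb (fun y => K < φ y C ∧ φ y C ≤ 2 * K) (hcard C)
  -- An element of [s * b] is a pair of a node and a rank below `b`; the clause at the node turns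
  -- the rank into a matching index.
  let fT : Fin (s * b) → DecisionTree (Refuter F s) (Fin N) := fun u =>
    .query (P := Refuter F s) (some (finProdFinEquiv.symm u).1)
      fun nd : ResNode V A (finProdFinEquiv.symm u).1 =>
        .leaf (dec nd.1 (finProdFinEquiv.symm u).2)
  -- Nodes that are not large, and positions beyond the last node, are fixed points. A large node
  -- without a suitable predecessor jumps back to 0, which makes it an `Iter` solution.
  let nextOf : Fin s → Fin s × Option (Option (Fin s × Clause V)) → Fin s := fun a o =>
    match o with
    | (_, none) => a
    | (_, some none) => ⟨0, hs⟩
    | (last, some (some (j, _))) => indexSub last j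
  let codeOf : Fin N → Fin s × Option (Option (Fin s × Clause V)) → Fin (s * b) := fun y o =>
    match o with
    | (_, some (some (j, C))) => finProdFinEquiv (j, enc C y)
    | _ => ⟨0, Nat.mul_pos hs hb⟩
  let ST : Fin N → Fin s → DecisionTree (Refuter F s) (Fin s) := fun y a =>
    (searchStep F (φ y) K a).map (nextOf a)
  let gT : Fin N → Fin s → DecisionTree (Refuter F s) (Fin (s * b)) := fun y a =>
    (searchStep F (φ y) K a).map (codeOf y)
  refine ⟨{
    inst := fun blk => match blk with
      | .inl u => fT u
      | .inr (.inl (y, a)) => ST y a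
      | .inr (.inr (y, a)) => gT y a
    sol := fun o => .query (P := Refuter F s) none fun last : Fin s =>
      .leaf (indexSub last o.2 : Fin s)
    inst_depth := ?_
    sol_depth := ?_
    size_le := hsize
    correct := ?_ }⟩
  · rintro (u | ⟨y, a⟩ | ⟨y, a⟩) x
    · have h : (Refuter F s).blockBits (some (finProdFinEquiv.symm u).1) + 0 ≤ d := by
        have := hB (some (finProdFinEquiv.symm u).1)
        omega
      exact h
    · exact ((DecisionTree.cost_map _ _ _).trans_le (cost_searchStep_le F _ K a x hB)).trans hd
    · exact ((DecisionTree.cost_map _ _ _).trans_le (cost_searchStep_le F _ K a x hB)).trans hd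
  · intro o x
    have h : (Refuter F s).blockBits none + 0 ≤ d := by
      have := hB none
      omega
    exact h
  · rintro x ⟨y, a⟩ ⟨hiter, hne⟩
    have hS : ∀ c : Fin s, (ST y c).eval x = nextOf c ((searchStep F (φ y) K c).eval x) :=
      fun c => DecisionTree.eval_map _ _ _
    have hg : (gT y a).eval x = codeOf y ((searchStep F (φ y) K a).eval x) :=
      DecisionTree.eval_map _ _ _
    have hf : ∀ j t, (fT (finProdFinEquiv (j, t))).eval x = dec (refuterNodes x j).1 t := by
      intro j t
      have h : ∀ p, p = (j, t) → dec (refuterNodes x p.1).1 p.2 = dec (refuterNodes x j).1 t := by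
        rintro _ rfl
        rfl
      exact h _ (finProdFinEquiv.symm_apply_apply (j, t))
    change Fin s at a
    change (((a : ℕ) = 0 ∧ (ST y a).eval x = a) ∨ (ST y a).eval x < a ∨
      (a < (ST y a).eval x ∧ (ST y ((ST y a).eval x)).eval x = (ST y a).eval x)) at hiter
    change (fT ((gT y a).eval x)).eval x ≠ y at hne
    change indexSub (x none : Fin s) a ≤ (x none : Fin s) ∧
      ¬ ValidNode F (Fin.val (n := s) (x none) + 1) (refuterNodes x) (indexSub (x none) a)
    obtain ⟨last, hlast⟩ : ∃ last : Fin s, (x none : Fin s) = last := ⟨_, rfl⟩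
    have hout : ∀ c, (searchStep F (φ y) K c).eval x = (last, if c ≤ last then
        if 2 * K < φ y (refuterNodes x (indexSub last c)).1 then
          some (choosePred (φ y) K (indexSub last c)
            (nodePreds (refuterNodes x (indexSub last c))).1
            (nodePreds (refuterNodes x (indexSub last c))).2
            (refClause F (refuterNodes x) (indexSub last c)
              (nodePreds (refuterNodes x (indexSub last c))).1)
            (refClause F (refuterNodes x) (indexSub last c)
              (nodePreds (refuterNodes x (indexSub last c))).2))
        else none else none) := by
      intro c
      rw [eval_searchStep, hlast, eval_nodeStep]
      rfl
    have hstay : ∀ c, (searchStep F (φ y) K c).eval x = (last, none) → (ST y c).eval x = c := by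
      intro c h
      rw [hS, h]
    have hback : ∀ c, (searchStep F (φ y) K c).eval x = (last, some none) →
        (ST y c).eval x = ⟨0, hs⟩ := by
      intro c h
      rw [hS, h]
    have hmove : ∀ c q, (searchStep F (φ y) K c).eval x = (last, some (some q)) →
        (ST y c).eval x = indexSub last q.1 := by
      intro c q h
      rw [hS, h]
    rw [hlast]
    refine ⟨Nat.sub_le _ _, ?_⟩
    have hval : ∀ c, ((indexSub last c : Fin s) : ℕ) = last - c := fun _ => rfl
    have houta := hout a
    by_cases hal : a ≤ last
    · rw [if_pos hal] at houta
      by_cases hl : 2 * K < φ y (refuterNodes x (indexSub last a)).1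
      · rw [if_pos hl] at houta
        rcases hch : choosePred (φ y) K (indexSub last a)
          (nodePreds (refuterNodes x (indexSub last a))).1
          (nodePreds (refuterNodes x (indexSub last a))).2
          (refClause F (refuterNodes x) (indexSub last a)
            (nodePreds (refuterNodes x (indexSub last a))).1)
          (refClause F (refuterNodes x) (indexSub last a)
            (nodePreds (refuterNodes x (indexSub last a))).2) with _ | q
        · exact fun hv => not_legalStep_of_choosePred_eq_none F (hax y) (hres y) (hweak y) _ _ hl
            hch hv.1
        · exfalso
          rw [hch] at houta
          obtain ⟨hji, hC, hK⟩ := choosePred_spec F _ _ _ hch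
          have hcode : codeOf y (last, some (some q)) = finProdFinEquiv (q.1, enc q.2 y) := rfl
          rw [hg, houta, hcode, hf, hC] at hne
          rw [hC] at hK
          rw [hmove a q houta] at hiter
          have hji' : (q.1 : ℕ) < last - a := hji
          have hinv : indexSub last (indexSub last q.1) = q.1 := by
            ext
            simp only [hval]
            omega
          have hle : indexSub last q.1 ≤ last := Nat.sub_le _ _
          -- A medium predecessor would be decoded back to `y`, contradicting `hne`.
          have hlarge : 2 * K < φ y (refuterNodes x q.1).1 := by
            by_contra hm
            exact hne (hdec _ _ ⟨hK, not_lt.1 hm⟩)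
          -- The predecessor is large, so it is not a fixed point: its step goes back to 0 or
          -- strictly forward. Since the step from `a` goes strictly forward as well, `a` does not
          -- solve `Iter`.
          have hout' := hout (indexSub last q.1)
          rw [if_pos hle, hinv, if_pos hlarge] at hout'
          rcases hch' : choosePred (φ y) K q.1
            (nodePreds (refuterNodes x q.1)).1
            (nodePreds (refuterNodes x q.1)).2
            (refClause F (refuterNodes x) q.1 (nodePreds (refuterNodes x q.1)).1)
            (refClause F (refuterNodes x) q.1 (nodePreds (refuterNodes x q.1)).2) with _ | r
          · rw [hch'] at hout'
            rw [hback _ hout'] at hiter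
            simp only [Fin.ext_iff, Fin.lt_def, hval] at hiter
            omega
          · obtain ⟨hkj, -, -⟩ := choosePred_spec F _ _ _ hch'
            have hkj' : (r.1 : ℕ) < q.1 := hkj
            rw [hch'] at hout'
            rw [hmove _ _ hout'] at hiter
            simp only [Fin.ext_iff, Fin.lt_def, hval] at hiter
            omega
      · rw [if_neg hl] at houta
        rw [hstay a houta] at hiter
        rintro ⟨-, hv⟩
        -- A fixed point solves `Iter` only at position 0, the last node. Its clause is not large,
        -- hence not empty.
        have ha : (a : ℕ) = 0 := by simpa using hiter
        rw [hv (by rw [hval, ha, Nat.sub_zero])] at hl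
        exact hl (hempty y)
    · rw [if_neg hal] at houta
      rw [hstay a houta] at hiter
      have ha : (a : ℕ) = 0 := by simpa using hiter
      exact absurd (Fin.le_def.2 (by omega)) hal

end Search

/-! ### Counting ordered partial matchings. -/

section Matchings

variable {n : ℕ}

/-- The free edges of a partial matching `l`, given as a list of pairs of a pigeon and a hole. -/
def freeEdges (l : List (Fin (n + 1) × Fin n)) : Finset (Fin (n + 1) × Fin n) :=
  (l.map Prod.fst).toFinsetᶜ ×ˢ (l.map Prod.snd).toFinsetᶜ

/-- The partial matchings with `k` edges, as lists. -/
def matchings (n : ℕ) : ℕ → Finset (List (Fin (n + 1) × Fin n))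
  | 0 => {[]}
  | k + 1 => (matchings n k).biUnion fun l => (freeEdges l).image (· :: l)

theorem mem_matchings_succ {k : ℕ} {l : List (Fin (n + 1) × Fin n)} :
    l ∈ matchings n (k + 1) ↔ ∃ l' ∈ matchings n k, ∃ x ∈ freeEdges l', x :: l' = l := by
  simp [matchings]

theorem matchings_spec {k : ℕ} {l : List (Fin (n + 1) × Fin n)} (h : l ∈ matchings n k) :
    l.length = k ∧ (l.map Prod.fst).Nodup ∧ (l.map Prod.snd).Nodup := by
  induction k generalizing l with
  | zero =>
    obtain rfl : l = [] := by simpa [matchings] using h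
    simp
  | succ k ih =>
    obtain ⟨l', hl', x, hx, rfl⟩ := mem_matchings_succ.1 h
    obtain ⟨h1, h2, h3⟩ := ih hl'
    simp only [freeEdges, Finset.mem_product, Finset.mem_compl, List.mem_toFinset] at hx
    rw [List.map_cons, List.map_cons, List.nodup_cons, List.nodup_cons]
    exact ⟨by simp [h1], ⟨hx.1, h2⟩, hx.2, h3⟩

theorem card_free_pigeons {k : ℕ} {l : List (Fin (n + 1) × Fin n)} (h : l ∈ matchings n k) :
    (l.map Prod.fst).toFinsetᶜ.card = n + 1 - k := by
  obtain ⟨h1, h2, h3⟩ := matchings_spec h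
  rw [Finset.card_compl, List.toFinset_card_of_nodup h2, List.length_map, h1, Fintype.card_fin]

theorem card_freeEdges {k : ℕ} {l : List (Fin (n + 1) × Fin n)} (h : l ∈ matchings n k) :
    (freeEdges l).card = (n + 1 - k) * (n - k) := by
  obtain ⟨h1, h2, h3⟩ := matchings_spec h
  rw [freeEdges, Finset.card_product, card_free_pigeons h, Finset.card_compl,
    List.toFinset_card_of_nodup h3, List.length_map, h1, Fintype.card_fin]

theorem card_matchings (k : ℕ) :
    (matchings n k).card = ∏ i ∈ Finset.range k, (n + 1 - i) * (n - i) := by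
  induction k with
  | zero => rfl
  | succ k ih =>
    rw [Finset.prod_range_succ, ← ih, matchings, Finset.card_biUnion]
    · rw [← smul_eq_mul, ← Finset.sum_const]
      refine Finset.sum_congr rfl fun l hl => ?_
      rw [Finset.card_image_of_injective _ fun _ _ h => (List.cons.inj h).1, card_freeEdges hl]
    · intro l _ l' _ hne
      simp only [Function.onFun, Finset.disjoint_left, Finset.mem_image]
      rintro _ ⟨x, _, rfl⟩ ⟨y, _, h⟩
      exact hne (List.cons.inj h).2.symm

/-- Few matchings avoid a set of edges that has many elements among the free edges. -/
theorem card_avoiding_matchings_le (E : Finset (Fin (n + 1) × Fin n)) (w k : ℕ) :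
    ((matchings n k).filter fun l => (∀ x ∈ l, x ∉ E) ∧ w ≤ (freeEdges l ∩ E).card).card ≤
      ∏ i ∈ Finset.range k, ((n + 1 - i) * (n - i) - w) := by
  induction k with
  | zero => exact Finset.card_filter_le _ _
  | succ k ih =>
    rw [Finset.prod_range_succ]
    refine le_trans ?_ (Nat.mul_le_mul_right _ ih)
    refine le_trans (Finset.card_le_card ?_) (Finset.card_biUnion_le_card_mul _
      (fun l => (freeEdges l \ E).image (· :: l)) _ ?_)
    · intro l hl
      obtain ⟨hl, hav, hw⟩ := Finset.mem_filter.1 hl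
      obtain ⟨l', hl', x, hx, rfl⟩ := mem_matchings_succ.1 hl
      -- Free edges only disappear as the matching grows, so a lower bound that holds at the end
      -- holds at every earlier stage; this lets the induction multiply the bounds.
      have hsub : freeEdges (x :: l') ⊆ freeEdges l' := by
        intro e
        simp only [freeEdges, Finset.mem_product, Finset.mem_compl, List.mem_toFinset,
          List.map_cons, List.mem_cons, not_or]
        exact fun h => ⟨h.1.2, h.2.2⟩
      refine Finset.mem_biUnion.2 ⟨l', Finset.mem_filter.2 ⟨hl', fun y hy => hav y (by simp [hy]),
        hw.trans (Finset.card_le_card (Finset.inter_subset_inter_right hsub))⟩,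
        Finset.mem_image.2 ⟨x, Finset.mem_sdiff.2 ⟨hx, hav x (by simp)⟩, rfl⟩⟩
    · intro l hl
      obtain ⟨hl, hav, hw⟩ := Finset.mem_filter.1 hl
      refine Finset.card_image_le.trans ?_
      rw [Finset.card_sdiff, card_freeEdges hl, Finset.inter_comm]
      exact Nat.sub_le_sub_left hw _

end Matchings

/-! ### Critical assignments and the measure of a clause. -/

section Critical

variable {n : ℕ}

/-- A critical assignment `α` maps each hole to the pigeon in it; it falsifies `C` if no literal
of `C` is true. -/
def Falsifies (α : Fin n → Fin (n + 1)) (C : Clause (Fin (n + 1) × Fin n)) : Prop :=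
  ∀ x ∈ C, decide (α x.1.2 = x.1.1) ≠ x.2

/-- `α` is injective, extends the partial matching `l`, and leaves out the pigeon `i`. -/
structure IsCritical (l : List (Fin (n + 1) × Fin n)) (i : Fin (n + 1))
    (α : Fin n → Fin (n + 1)) : Prop where
  inj : Function.Injective α
  ext : ∀ x ∈ l, α x.2 = x.1
  missed : ∀ j, α j ≠ i

open Classical in
/-- The pigeons left out by critical assignments that extend `l` and falsify `C`. -/
noncomputable def witnesses (l : List (Fin (n + 1) × Fin n)) (C : Clause (Fin (n + 1) × Fin n)) :
    Finset (Fin (n + 1)) :=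
  Finset.univ.filter fun i => ∃ α, IsCritical l i α ∧ Falsifies α C

variable {l : List (Fin (n + 1) × Fin n)} {C : Clause (Fin (n + 1) × Fin n)} {i : Fin (n + 1)}

theorem mem_witnesses : i ∈ witnesses l C ↔ ∃ α, IsCritical l i α ∧ Falsifies α C := by
  simp [witnesses]

/-- An injection of the n holes into the n pigeons other than `i` is onto. -/
theorem IsCritical.exists_eq {α : Fin n → Fin (n + 1)} (h : IsCritical l i α)
    {i' : Fin (n + 1)} (hi : i' ≠ i) : ∃ j, α j = i' := by
  have himg : Finset.univ.image α = Finset.univ.erase i := by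
    apply Finset.eq_of_subset_of_card_le
    · intro x hx
      obtain ⟨j, -, rfl⟩ := Finset.mem_image.1 hx
      exact Finset.mem_erase.2 ⟨h.missed j, Finset.mem_univ _⟩
    · rw [Finset.card_image_of_injective _ h.inj, Finset.card_erase_of_mem (Finset.mem_univ _)]
      simp
  have : i' ∈ Finset.univ.image α := himg ▸ Finset.mem_erase.2 ⟨hi, Finset.mem_univ _⟩
  simpa using this

theorem witnesses_subset_free : witnesses l C ⊆ (l.map Prod.fst).toFinsetᶜ := by
  intro i hi
  obtain ⟨α, hα, -⟩ := mem_witnesses.1 hi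
  simp only [Finset.mem_compl, List.mem_toFinset, List.mem_map, not_exists, not_and]
  rintro x hx rfl
  exact hα.missed _ (hα.ext x hx)

theorem witnesses_empty {k : ℕ} (hl : l ∈ matchings n k) :
    witnesses l ∅ = (l.map Prod.fst).toFinsetᶜ := by
  refine witnesses_subset_free.antisymm fun i hi => mem_witnesses.2 ?_
  obtain ⟨-, h1, h2⟩ := matchings_spec hl
  have hex : ∀ j : Fin n, j ∈ (l.map Prod.snd).toFinset → ∃ p, (p, j) ∈ l := by
    intro j hj
    simpa using hj
  choose! f hf using hex
  -- The n holes and the n pigeons other than `i` are equinumerous, so the matching extends to a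
  -- bijection between them.
  obtain ⟨g, hg⟩ := Finset.exists_equiv_extend_of_card_eq (t := Finset.univ.erase i)
    (s := (l.map Prod.snd).toFinset) (f := f) (by simp) (by
      intro p hp
      obtain ⟨j, hj, rfl⟩ := Finset.mem_image.1 hp
      refine Finset.mem_erase.2 ⟨?_, Finset.mem_univ _⟩
      rintro rfl
      simp only [Finset.mem_compl, List.mem_toFinset, List.mem_map, not_exists, not_and] at hi
      exact hi _ (hf j hj) rfl) (by
      intro j hj j' hj' he
      exact congrArg Prod.snd (List.inj_on_of_nodup_map h1 (hf j hj) (hf j' hj') he))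
  refine ⟨fun j => g j, ⟨fun j j' h => g.injective (Subtype.ext h), fun x hx => ?_, fun j =>
    (Finset.mem_erase.1 (g j).2).1⟩, by simp [Falsifies]⟩
  have hx2 : x.2 ∈ (l.map Prod.snd).toFinset := by
    rw [List.mem_toFinset]
    exact List.mem_map_of_mem hx
  rw [hg _ hx2]
  exact congrArg Prod.fst (List.inj_on_of_nodup_map h2 (hf _ hx2) hx rfl)

/-- A pigeon clause fails only if its own pigeon is left out; a hole clause fails only if two
pigeons share a hole, which never happens. -/
theorem card_witnesses_PHP_le (a : PHPAxiom (n + 1) n) :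
    (witnesses l (PHP (n + 1) n a)).card ≤ 1 := by
  rcases a with p | ⟨⟨⟨p, p'⟩, hp⟩, j⟩
  · rw [Finset.card_le_one]
    have key : ∀ i ∈ witnesses l (PHP (n + 1) n (.inl p)), i = p := by
      intro i hi
      obtain ⟨α, hα, hf⟩ := mem_witnesses.1 hi
      by_contra hne
      obtain ⟨j, hj⟩ := hα.exists_eq (Ne.symm hne)
      exact hf ((p, j), true) (Finset.mem_image.2 ⟨j, Finset.mem_univ _, rfl⟩) (by simp [hj])
    intro i hi i' hi'
    rw [key i hi, key i' hi']
  · refine (Finset.card_eq_zero.2 (Finset.eq_empty_of_forall_notMem fun i hi => ?_)).trans_le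
      zero_le_one
    obtain ⟨α, hα, hf⟩ := mem_witnesses.1 hi
    have h1 := hf ((p, j), false) (by simp [PHP])
    have h2 := hf ((p', j), false) (by simp [PHP])
    simp only [ne_eq, decide_eq_false_iff_not, not_not] at h1 h2
    exact (ne_of_lt hp) (h1.symm.trans h2)

/-- An assignment that falsifies the resolvent falsifies one of the premises, depending on the value
of `v`. -/
theorem card_witnesses_resolution_le (v : Fin (n + 1) × Fin n)
    (D E : Clause (Fin (n + 1) × Fin n)) :
    (witnesses l (D ∪ E)).card ≤
      (witnesses l ({(v, true)} ∪ D)).card + (witnesses l ({(v, false)} ∪ E)).card := by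
  refine (Finset.card_le_card fun i hi => ?_).trans (Finset.card_union_le _ _)
  obtain ⟨α, hα, hf⟩ := mem_witnesses.1 hi
  simp only [Finset.mem_union, mem_witnesses]
  by_cases hv : α v.2 = v.1
  · right
    refine ⟨α, hα, fun x hx => ?_⟩
    rcases Finset.mem_union.1 hx with hx | hx
    · obtain rfl := Finset.mem_singleton.1 hx
      simp [hv]
    · exact hf x (Finset.mem_union_right _ hx)
  · left
    refine ⟨α, hα, fun x hx => ?_⟩
    rcases Finset.mem_union.1 hx with hx | hx
    · obtain rfl := Finset.mem_singleton.1 hx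
      simp [hv]
    · exact hf x (Finset.mem_union_left _ hx)

theorem card_witnesses_weakening_le (C D : Clause (Fin (n + 1) × Fin n)) :
    (witnesses l (C ∪ D)).card ≤ (witnesses l C).card := by
  refine Finset.card_le_card fun i hi => ?_
  obtain ⟨α, hα, hf⟩ := mem_witnesses.1 hi
  exact mem_witnesses.2 ⟨α, hα, fun x hx => hf x (Finset.mem_union_left _ hx)⟩

open Classical in
/-- The literals of the monotone version of a clause: a negative literal is replaced by the
disjunction of the variables that put another pigeon into the same hole. -/
noncomputable def monotoneEdges (C : Clause (Fin (n + 1) × Fin n)) :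
    Finset (Fin (n + 1) × Fin n) :=
  Finset.univ.filter fun e => (e, true) ∈ C ∨ ∃ p, p ≠ e.1 ∧ ((p, e.2), false) ∈ C

/-- Critical assignments fill every hole, so a negative literal is true exactly when another pigeon
sits in its hole. -/
theorem falsifies_iff_forall_notMem_monotoneEdges (α : Fin n → Fin (n + 1)) :
    Falsifies α C ↔ ∀ j, (α j, j) ∉ monotoneEdges C := by
  simp only [monotoneEdges, Finset.mem_filter, Finset.mem_univ, true_and, not_or, not_exists,
    not_and]
  constructor
  · intro h j
    exact ⟨fun hj => h _ hj (by simp), fun p hp hj => h _ hj (by simpa using hp.symm)⟩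
  · rintro h ⟨⟨p, j⟩, b⟩ hx
    cases b
    · by_contra hc
      rw [decide_eq_false_iff_not] at hc
      exact (h j).2 p (Ne.symm hc) hx
    · by_contra hc
      rw [decide_eq_true_eq] at hc
      change α j = p at hc
      subst hc
      exact (h j).1 hx

theorem notMem_monotoneEdges_of_mem (hi : i ∈ witnesses l C) :
    ∀ x ∈ l, x ∉ monotoneEdges C := by
  obtain ⟨α, hα, hf⟩ := mem_witnesses.1 hi
  rintro ⟨p, j⟩ hx
  have := (falsifies_iff_forall_notMem_monotoneEdges α).1 hf j
  rwa [hα.ext _ hx] at this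

/-- Moving the left out pigeon into the hole of a pigeon that is not a witness makes the clause
true. -/
theorem exists_mem_monotoneEdges {α : Fin n → Fin (n + 1)} (hα : IsCritical l i α)
    (hf : Falsifies α C) {i' : Fin (n + 1)} (hfree : i' ∈ (l.map Prod.fst).toFinsetᶜ)
    (hi' : i' ∉ witnesses l C) :
    ∃ j, α j = i' ∧ (i, j) ∈ freeEdges l ∩ monotoneEdges C := by
  have hi : i ∈ witnesses l C := mem_witnesses.2 ⟨α, hα, hf⟩
  have hne : i' ≠ i := by
    rintro rfl
    exact hi' hi
  obtain ⟨j, hj⟩ := hα.exists_eq hne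
  have hjl : ∀ x ∈ l, x.2 ≠ j := by
    rintro x hx rfl
    simp only [Finset.mem_compl, List.mem_toFinset, List.mem_map, not_exists, not_and] at hfree
    exact hfree x hx ((hα.ext x hx).symm.trans hj)
  refine ⟨j, hj, Finset.mem_inter.2 ⟨Finset.mem_product.2 ⟨witnesses_subset_free hi, ?_⟩, ?_⟩⟩
  · simp only [Finset.mem_compl, List.mem_toFinset, List.mem_map, not_exists, not_and]
    exact hjl
  · by_contra hE
    refine hi' (mem_witnesses.2 ⟨Function.update α j i, ⟨?_, ?_, ?_⟩, ?_⟩)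
    · intro a b h
      rcases eq_or_ne a j with rfl | ha <;> rcases eq_or_ne b a with rfl | hb
      · rfl
      · rw [Function.update_self, Function.update_of_ne hb] at h
        exact absurd h.symm (hα.missed b)
      · rfl
      · rw [Function.update_of_ne ha] at h
        rcases eq_or_ne b j with rfl | hbj
        · rw [Function.update_self] at h
          exact absurd h (hα.missed a)
        · rw [Function.update_of_ne hbj] at h
          exact hα.inj h
    · intro x hx
      rw [Function.update_of_ne (hjl x hx)]
      exact hα.ext x hx
    · intro j'
      rcases eq_or_ne j' j with rfl | h
      · simpa using hne.symm
      · rw [Function.update_of_ne h, ← hj]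
        exact fun h' => h (hα.inj h')
    · rw [falsifies_iff_forall_notMem_monotoneEdges] at hf ⊢
      intro j'
      rcases eq_or_ne j' j with rfl | h
      · simpa using hE
      · rw [Function.update_of_ne h]
        exact hf j'

/-- Fix a critical assignment for each witness i. A free non-witness i' is sent to the edge from i
to the hole of i' in that assignment; the assignment of i recovers i' from the edge, so different
pairs give different edges. -/
theorem card_witnesses_mul_le :
    (witnesses l C).card * ((l.map Prod.fst).toFinsetᶜ \ witnesses l C).card ≤
      (freeEdges l ∩ monotoneEdges C).card := by
  have hex : ∀ i ∈ witnesses l C, ∃ α, IsCritical l i α ∧ Falsifies α C :=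
    fun i hi => mem_witnesses.1 hi
  choose! α hα hf using hex
  rw [← Finset.card_product]
  refine Finset.card_le_card_of_surjOn (fun e => (e.1, α e.1 e.2)) ?_
  rintro ⟨i, i'⟩ hx
  obtain ⟨h1, h2⟩ := Finset.mem_product.1 (Finset.mem_coe.1 hx)
  obtain ⟨h2, h3⟩ := Finset.mem_sdiff.1 h2
  obtain ⟨j, rfl, hj⟩ := exists_mem_monotoneEdges (hα i h1) (hf i h1) h2 h3
  exact ⟨(i, j), hj, rfl⟩

/-- A clause has a medium number of witnesses for few matchings only. -/
theorem card_medium_matchings_le {K t : ℕ} (h3 : n + 1 - t = 3 * K)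
    (C : Clause (Fin (n + 1) × Fin n)) :
    ((matchings n t).filter fun l =>
      K < (witnesses l C).card ∧ (witnesses l C).card ≤ 2 * K).card ≤
      ∏ i ∈ Finset.range t, ((n + 1 - i) * (n - i) - 2 * K ^ 2) := by
  refine le_trans (Finset.card_le_card fun l hl => ?_)
    (card_avoiding_matchings_le (monotoneEdges C) (2 * K ^ 2) t)
  obtain ⟨hl, h1, h2⟩ := Finset.mem_filter.1 hl
  refine Finset.mem_filter.2 ⟨hl, ?_, ?_⟩
  · obtain ⟨i, hi⟩ := Finset.card_pos.1 ((Nat.zero_le K).trans_lt h1)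
    exact notMem_monotoneEdges_of_mem hi
  · refine le_trans ?_ card_witnesses_mul_le
    rw [Finset.card_sdiff_of_subset witnesses_subset_free, card_free_pigeons hl, h3]
    -- With K + a witnesses and K + b free non-witnesses, where a + b = K, the product is 2K^2 + ab.
    obtain ⟨a, ha⟩ := Nat.exists_eq_add_of_le h1.le
    obtain ⟨b, hb⟩ := Nat.exists_eq_add_of_le h2
    have hab : K = a + b := by omega
    have : 3 * K - (witnesses l C).card = K + b := by omega
    rw [this, ha]
    nlinarith [Nat.zero_le (a * b)]

end Critical

/-! ### Bit-lengths of the two problems. -/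

section Sizes

theorem size_rwPHP_le {L M N e : ℕ} (hM : M ≤ N) (hN : N ≤ 2 ^ e) (hL : L ≤ 2 ^ e) :
    (rwPHP (Iter L) M N).size ≤ 2 ^ (3 * e + 2) := by
  have hbits : ∀ b, (rwPHP (Iter L) M N).blockBits b ≤ e := by
    rintro (u | ⟨y, a⟩ | ⟨y, a⟩)
    · change Nat.clog 2 (Nat.card (Fin N)) ≤ e
      rw [Nat.card_fin]
      exact Nat.clog_le_of_le_pow hN
    · change Nat.clog 2 (Nat.card (Fin L)) ≤ e
      rw [Nat.card_fin]
      exact Nat.clog_le_of_le_pow hL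
    · change Nat.clog 2 (Nat.card (Fin M)) ≤ e
      rw [Nat.card_fin]
      exact Nat.clog_le_of_le_pow (hM.trans hN)
  have hcard : Fintype.card (rwPHP (Iter L) M N).Block = M + (N * L + N * L) := by
    rw [← Nat.card_eq_fintype_card]
    change Nat.card (Fin M ⊕ (Fin N × Fin L) ⊕ (Fin N × Fin L)) = _
    simp
  have h1 : (rwPHP (Iter L) M N).size ≤ (M + (N * L + N * L)) * e := by
    rw [← hcard]
    exact Finset.sum_le_card_nsmul _ _ _ fun b _ => hbits b
  have h2 : N * L ≤ 2 ^ e * 2 ^ e := Nat.mul_le_mul hN hL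
  have h3 : e ≤ 2 ^ e := Nat.lt_two_pow_self.le
  have h4 : 1 ≤ 2 ^ e := Nat.one_le_two_pow
  have h5 : M ≤ 2 ^ e * 2 ^ e := (hM.trans hN).trans (Nat.le_mul_of_pos_left _ h4)
  calc (rwPHP (Iter L) M N).size ≤ (M + (N * L + N * L)) * e := h1
    _ ≤ (4 * (2 ^ e * 2 ^ e)) * 2 ^ e := Nat.mul_le_mul (by omega) h3
    _ = 2 ^ (3 * e + 2) := by ring

theorem blockBits_refuter_PHP_le {n s : ℕ} (hn : 1 ≤ n) (hs : s ≤ 2 ^ n)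
    (b : (Refuter (PHP (n + 1) n) s).Block) :
    (Refuter (PHP (n + 1) n) s).blockBits b ≤ 17 * n ^ 2 := by
  have hnn : n ≤ n ^ 2 := Nat.le_self_pow two_ne_zero n
  rcases b with _ | i
  · change Nat.clog 2 (Nat.card (Fin s)) ≤ _
    rw [Nat.card_fin]
    exact (Nat.clog_le_of_le_pow hs).trans (by omega)
  · change Nat.clog 2 (Nat.card (ResNode (Fin (n + 1) × Fin n) (PHPAxiom (n + 1) n) i)) ≤ _
    apply Nat.clog_le_of_le_pow
    have hn1 : n + 1 ≤ 2 ^ n := Nat.lt_two_pow_self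
    have hn0 : n ≤ 2 ^ n := Nat.lt_two_pow_self.le
    have hpos : 1 ≤ 2 ^ n := Nat.one_le_two_pow
    have hA : Nat.card (PHPAxiom (n + 1) n) ≤ (n + 1) + (n + 1) * (n + 1) * n := by
      rw [Nat.card_eq_fintype_card, Fintype.card_sum, Fintype.card_prod, Fintype.card_fin,
        Fintype.card_fin]
      refine Nat.add_le_add_left (Nat.mul_le_mul_right _ ?_) _
      exact (Fintype.card_subtype_le _).trans (by simp)
    have hr : Nat.card (NodeRef (PHPAxiom (n + 1) n) i) ≤ 2 ^ (5 * n) := by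
      rw [Nat.card_sum, Nat.card_fin]
      have h1 : (n + 1) * (n + 1) * n ≤ 2 ^ n * 2 ^ n * 2 ^ n := by gcongr
      have hi : (i : ℕ) ≤ 2 ^ n := i.isLt.le.trans hs
      have h2 : 2 ^ n ≤ 2 ^ n * 2 ^ n * 2 ^ n := by nlinarith [Nat.mul_le_mul hpos hpos]
      have h3 : (2 : ℕ) ≤ 2 ^ n := by
        simpa using Nat.pow_le_pow_right (n := 2) two_pos hn
      calc _ ≤ 2 * 2 * (2 ^ n * 2 ^ n * 2 ^ n) := by omega
        _ ≤ 2 ^ n * 2 ^ n * (2 ^ n * 2 ^ n * 2 ^ n) := by gcongr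
        _ = 2 ^ (5 * n) := by ring
    have hV : Nat.card (Fin (n + 1) × Fin n) = (n + 1) * n := by simp
    have hC : Nat.card (Clause (Fin (n + 1) × Fin n)) = 2 ^ ((n + 1) * n * 2) := by
      rw [Nat.card_eq_fintype_card, Fintype.card_finset]
      simp
    rw [Nat.card_prod, Nat.card_sum, Nat.card_prod, hV, Nat.card_prod, hC]
    set r := Nat.card (NodeRef (PHPAxiom (n + 1) n) i)
    have h1 : (n + 1) * n * (r * r) + r ≤ 2 ^ (13 * n) := by
      have h2 : (2 : ℕ) ≤ 2 ^ n := by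
        simpa using Nat.pow_le_pow_right (n := 2) two_pos hn
      have h3 : (n + 1) * n * (r * r) ≤ 2 ^ n * 2 ^ n * (2 ^ (5 * n) * 2 ^ (5 * n)) := by gcongr
      have h4 : 2 ^ n * 2 ^ n * (2 ^ (5 * n) * 2 ^ (5 * n)) = 2 ^ (12 * n) := by ring
      have h5 : 2 ^ (5 * n) ≤ 2 ^ (12 * n) := Nat.pow_le_pow_right two_pos (by omega)
      calc _ ≤ 2 * 2 ^ (12 * n) := by omega
        _ ≤ 2 ^ n * 2 ^ (12 * n) := by gcongr
        _ = 2 ^ (13 * n) := by ring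
    calc _ ≤ 2 ^ ((n + 1) * n * 2) * 2 ^ (13 * n) := Nat.mul_le_mul_left _ h1
      _ = 2 ^ ((n + 1) * n * 2 + 13 * n) := (pow_add _ _ _).symm
      _ ≤ 2 ^ (17 * n ^ 2) := Nat.pow_le_pow_right two_pos (by nlinarith)

/-- Each node block carries at least one bit. This makes the logarithm of the input size linear in n
once `s` is exponential, so depth polynomial in n is polylogarithmic. -/
theorem le_size_refuter_PHP {n s : ℕ} (hn : 1 ≤ n) :
    s ≤ (Refuter (PHP (n + 1) n) s).size := by
  have hbits : ∀ i : Fin s, 1 ≤ (Refuter (PHP (n + 1) n) s).blockBits (some i) := by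
    intro i
    change 1 ≤ Nat.clog 2 (Nat.card (ResNode (Fin (n + 1) × Fin n) (PHPAxiom (n + 1) n) i))
    refine Nat.clog_pos one_lt_two (Finite.one_lt_card_iff_nontrivial.2 ?_)
    let w : (((Fin (n + 1) × Fin n) × NodeRef (PHPAxiom (n + 1) n) i ×
      NodeRef (PHPAxiom (n + 1) n) i) ⊕ NodeRef (PHPAxiom (n + 1) n) i) := .inr (.inl (.inl 0))
    refine ⟨(∅, w), ({((0, ⟨0, hn⟩), true)}, w), fun h => ?_⟩
    exact Finset.singleton_ne_empty _ (Prod.mk.inj h).1.symm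
  calc s = ∑ i : Fin s, 1 := by simp
    _ ≤ ∑ i : Fin s, (Refuter (PHP (n + 1) n) s).blockBits (some i) :=
      Finset.sum_le_sum fun i _ => hbits i
    _ ≤ (Refuter (PHP (n + 1) n) s).blockBits none +
        ∑ i : Fin s, (Refuter (PHP (n + 1) n) s).blockBits (some i) := Nat.le_add_left _ _
    _ = (Refuter (PHP (n + 1) n) s).size :=
      (Fintype.sum_option (Refuter (PHP (n + 1) n) s).blockBits).symm

end Sizes

/-! ### Choice of parameters and conclusion. -/

/-- No refutation of the pigeonhole principle consists of a single node. -/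
theorem not_validNode_PHP_of_one_node {n : ℕ} (hn : 1 ≤ n)
    (nodes : ∀ i : Fin 1, ResNode (Fin (n + 1) × Fin n) (PHPAxiom (n + 1) n) i) (i : Fin 1) :
    ¬ ValidNode (PHP (n + 1) n) 1 nodes i := by
  rintro ⟨hleg, hlast⟩
  have hC := hlast (by omega)
  have href : ∀ r : NodeRef (PHPAxiom (n + 1) n) i,
      ∃ a, refClause (PHP (n + 1) n) nodes i r = PHP (n + 1) n a := by
    rintro (a | j)
    · exact ⟨a, rfl⟩
    · have := j.isLt
      omega
  unfold LegalStep at hleg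
  rcases hnd : (nodes i).2 with ⟨v, j, k⟩ | j
  · rw [hnd] at hleg
    obtain ⟨D, E, -, hk, h⟩ := hleg
    rw [hC] at h
    -- The second premise would be a single negative literal, and no axiom has that form.
    obtain ⟨-, rfl⟩ := Finset.union_eq_empty.1 h.symm
    obtain ⟨a, ha⟩ := href k
    rw [ha, Finset.union_empty] at hk
    rcases a with p | ⟨⟨⟨p, p'⟩, hp⟩, j⟩
    · have hm : (v, false) ∈ PHP (n + 1) n (.inl p) := by simp [hk]
      simp [PHP] at hm
    · have h1 : ((p, j), false) ∈ ({(v, false)} : Clause (Fin (n + 1) × Fin n)) := by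
        rw [← hk]
        simp [PHP]
      have h2 : ((p', j), false) ∈ ({(v, false)} : Clause (Fin (n + 1) × Fin n)) := by
        rw [← hk]
        simp [PHP]
      have h3 := (Finset.mem_singleton.1 h1).trans (Finset.mem_singleton.1 h2).symm
      exact (ne_of_lt hp) (congrArg (fun x => x.1.1) h3)
  · rw [hnd] at hleg
    obtain ⟨D, h⟩ := hleg
    rw [hC] at h
    have h := (Finset.union_eq_empty.1 h.symm).1
    obtain ⟨a, ha⟩ := href j
    rw [ha] at h
    rcases a with p | ⟨p, j⟩
    · have hm : ((p, ⟨0, hn⟩), true) ∈ PHP (n + 1) n (.inl p) := by simp [PHP]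
      simp [h] at hm
    · simp [PHP] at h

/-- The only node is always invalid, so constant trees suffice. -/
theorem refuter_PHP_one_reduction {n d : ℕ} (hn : 1 ≤ n) (hd : 5 ≤ d) :
    Nonempty (DTReduction (Refuter (PHP (n + 1) n) 1)
      (rwPHPPLS ⟨1, 2, 1, le_rfl, le_rfl, le_rfl⟩) d) := by
  refine ⟨{
    inst := fun blk => match blk with
      | .inl _ => .leaf (0 : Fin 2)
      | .inr (.inl _) => .leaf (0 : Fin 1)
      | .inr (.inr _) => .leaf (0 : Fin 1)
    sol := fun _ => .leaf (0 : Fin 1)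
    inst_depth := ?_
    sol_depth := fun _ _ => Nat.zero_le _
    size_le := (size_rwPHP_le (e := 1) one_le_two le_rfl one_le_two).trans
      (Nat.pow_le_pow_right two_pos hd)
    correct := ?_ }⟩
  · rintro (_ | _ | _) x <;> exact Nat.zero_le _
  · intro x o _
    obtain ⟨last, hlast⟩ : ∃ last : Fin 1, x none = last := ⟨_, rfl⟩
    refine ⟨Nat.zero_le (Fin.val (n := 1) (x none)), ?_⟩
    change ¬ ValidNode (PHP (n + 1) n) (Fin.val (n := 1) (x none) + 1) (refuterNodes x) (0 : Fin 1)
    rw [hlast, Subsingleton.elim last 0]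
    exact not_validNode_PHP_of_one_node hn _ _

/-- The medium matchings are a small fraction of all matchings. -/
theorem two_mul_mul_prod_le {n K s t : ℕ} (hK : 1 ≤ K) (hnK : n < 6 * K + 6) (h6 : 6 * K ≤ n)
    (ht : n + 1 - t = 3 * K) (hs : 2 * s * 65 ^ t ≤ 66 ^ t) :
    2 * (s * ∏ i ∈ Finset.range t, ((n + 1 - i) * (n - i) - 2 * K ^ 2)) ≤
      ∏ i ∈ Finset.range t, (n + 1 - i) * (n - i) := by
  have hfac : 66 ^ t * ∏ i ∈ Finset.range t, ((n + 1 - i) * (n - i) - 2 * K ^ 2) ≤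
      65 ^ t * ∏ i ∈ Finset.range t, (n + 1 - i) * (n - i) := by
    have h66 : ∀ a : ℕ, a ^ t = ∏ _i ∈ Finset.range t, a := by simp
    rw [h66, h66, ← Finset.prod_mul_distrib, ← Finset.prod_mul_distrib]
    refine Finset.prod_le_prod' fun i _ => ?_
    -- Here n + 1 ≤ 6K + 6 ≤ 12K and n ≤ 6K + 5 ≤ 11K, so 2K^2 edges are at least a 1/66 fraction.
    have h1 : (n + 1 - i) * (n - i) ≤ (12 * K) * (11 * K) :=
      Nat.mul_le_mul (by omega) (by omega)
    have h2 : (12 * K) * (11 * K) = 66 * (2 * K ^ 2) := by ring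
    omega
  have hpos : 0 < 65 ^ t := by positivity
  refine le_of_mul_le_mul_left ?_ hpos
  refine le_trans ?_ hfac
  calc _ = (2 * s * 65 ^ t) *
        ∏ i ∈ Finset.range t, ((n + 1 - i) * (n - i) - 2 * K ^ 2) := by ring
    _ ≤ _ := Nat.mul_le_mul_right _ hs

theorem refuter_PHP_reduction {n s : ℕ} (hn : 6 ≤ n) (hs : 0 < s) (hs2 : s ≤ 2 ^ n)
    (hs3 : ∀ t, n ≤ 2 * t → 2 * s * 65 ^ t ≤ 66 ^ t) :
    ∃ j, Nonempty (DTReduction (Refuter (PHP (n + 1) n) s) (rwPHPPLS j) (68 * n ^ 2)) := by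
  obtain ⟨K, hKdef⟩ : ∃ K, K = n / 6 := ⟨_, rfl⟩
  obtain ⟨t, htdef⟩ : ∃ t, t = n + 1 - 3 * K := ⟨_, rfl⟩
  have hK : 1 ≤ K := by omega
  have ht : n + 1 - t = 3 * K := by omega
  have hnn : 1 ≤ n ^ 2 := Nat.one_le_pow _ _ (by omega)
  let b := ∏ i ∈ Finset.range t, ((n + 1 - i) * (n - i) - 2 * K ^ 2)
  have hb : 0 < b := by
    refine Finset.prod_pos fun i hi => ?_
    have hi := Finset.mem_range.1 hi
    have h1 : (3 * K) * (3 * K) ≤ (n + 1 - i) * (n - i) :=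
      Nat.mul_le_mul (by omega) (by omega)
    have h2 : 2 * K ^ 2 < (3 * K) * (3 * K) := by nlinarith
    omega
  have hN : 2 * (s * b) ≤ (matchings n t).card := by
    rw [card_matchings]
    exact two_mul_mul_prod_le hK (by omega) (by omega) ht (hs3 t (by omega))
  let e := (matchings n t).equivFin
  have hNle : (matchings n t).card ≤ 2 ^ (2 * n ^ 2) := by
    rw [card_matchings]
    calc _ ≤ ∏ _i ∈ Finset.range t, 2 ^ n * 2 ^ n :=
          Finset.prod_le_prod' fun i _ => Nat.mul_le_mul
            ((Nat.sub_le _ _).trans Nat.lt_two_pow_self)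
            ((Nat.sub_le _ _).trans Nat.lt_two_pow_self.le)
      _ = 2 ^ (2 * n * t) := by
        rw [Finset.prod_const, Finset.card_range]
        ring
      _ ≤ 2 ^ (2 * n ^ 2) := Nat.pow_le_pow_right two_pos (by
        have : t ≤ n := by omega
        nlinarith)
  refine ⟨_, refuter_reduction (PHP (n + 1) n) (K := K) (B := 17 * n ^ 2) hs hb hN
    (fun y C => (witnesses (e.symm y).1 C).card) ?_ ?_ ?_ ?_ ?_ ?_ (by omega) ?_⟩
  · intro y
    rw [witnesses_empty (e.symm y).2, card_free_pigeons (e.symm y).2, ht]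
    omega
  · exact fun y a => (card_witnesses_PHP_le a).trans hK
  · exact fun y v D E => card_witnesses_resolution_le v D E
  · exact fun y C D => card_witnesses_weakening_le C D
  · intro C
    refine le_trans ?_ (card_medium_matchings_le ht C)
    refine Finset.card_le_card_of_injOn (fun y => (e.symm y).1) ?_ ?_
    · intro y hy
      exact Finset.mem_coe.2 (Finset.mem_filter.2
        ⟨(e.symm y).2, (Finset.mem_filter.1 (Finset.mem_coe.1 hy)).2⟩)
    · exact fun y _ y' _ h => e.symm.injective (Subtype.ext h)
  · exact blockBits_refuter_PHP_le (by omega) hs2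
  · refine (size_rwPHP_le (e := 2 * n ^ 2) (by omega) hNle (hs2.trans ?_)).trans
      (Nat.pow_le_pow_right two_pos (by omega))
    exact Nat.pow_le_pow_right two_pos (by nlinarith)

theorem depth_bound {n x : ℕ} (hx : 2 ≤ x) (hn : n ≤ 1000 * x) : 68 * n ^ 2 ≤ x ^ 29 := by
  have h7 : 2 ^ 7 ≤ x ^ 7 := Nat.pow_le_pow_left hx 7
  have h10 : 2 ^ 10 ≤ x ^ 10 := Nat.pow_le_pow_left hx 10
  have h11 : n ≤ x ^ 11 := by
    calc n ≤ 1000 * x := hn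
      _ ≤ x ^ 10 * x := Nat.mul_le_mul_right _ (by omega)
      _ = x ^ 11 := (pow_succ _ _).symm
  calc 68 * n ^ 2 ≤ x ^ 7 * (x ^ 11) ^ 2 :=
        Nat.mul_le_mul (by omega) (Nat.pow_le_pow_left h11 2)
    _ = x ^ 29 := by ring

theorem mainTheorem3 :
    ∃ c : ℝ, 1 < c ∧
      EfficientlyReducible
        (fun n : ℕ+ => Refuter (PHP ((n : ℕ) + 1) (n : ℕ)) ⌊c ^ (n : ℕ)⌋₊)
        rwPHPPLS := by
  -- The constant has to satisfy c^4 ≤ 66/65, and c^1000 ≥ 2 for the bound on the logarithm.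
  obtain ⟨c, hc⟩ : ∃ c : ℝ, c = 1001 / 1000 := ⟨_, rfl⟩
  refine ⟨c, by norm_num [hc], 29, ?_⟩
  rintro ⟨n, hn⟩
  simp only [PNat.mk_coe]
  have hc1 : (1 : ℝ) ≤ c := by norm_num [hc]
  have hs1 : 1 ≤ ⌊c ^ n⌋₊ := Nat.le_floor (by simpa using one_le_pow₀ hc1)
  have hsle : (⌊c ^ n⌋₊ : ℝ) ≤ c ^ n := Nat.floor_le (by positivity)
  have hlog : n / 1000 ≤ Nat.log 2 (Refuter (PHP (n + 1) n) ⌊c ^ n⌋₊).size := by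
    refine Nat.le_log_of_pow_le one_lt_two (le_trans ?_ (le_size_refuter_PHP hn))
    refine Nat.le_floor ?_
    have h2 : (2 : ℝ) ≤ c ^ 1000 := by
      have := one_add_mul_le_pow (a := (1 / 1000 : ℝ)) (by norm_num) 1000
      rw [hc]
      norm_num at this
      exact this
    push_cast
    calc (2 : ℝ) ^ (n / 1000) ≤ (c ^ 1000) ^ (n / 1000) := by gcongr
      _ = c ^ (1000 * (n / 1000)) := (pow_mul _ _ _).symm
      _ ≤ c ^ n := pow_le_pow_right₀ hc1 (Nat.mul_div_le _ _)
  have hdepth : 68 * n ^ 2 ≤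
      (Nat.log 2 (Refuter (PHP (n + 1) n) ⌊c ^ n⌋₊).size + 2) ^ 29 :=
    depth_bound (by omega) (by omega)
  -- Below 2 only one node is allowed. Otherwise the bound c^n ≥ 2 absorbs the factor 2 in `hs3`.
  by_cases h2 : c ^ n < 2
  · have h1 : ⌊c ^ n⌋₊ = 1 := le_antisymm
      (Nat.lt_succ_iff.1 ((Nat.floor_lt (by positivity)).2 (by simpa using h2))) hs1
    rw [h1] at hdepth ⊢
    have hd : 5 ≤ 68 * n ^ 2 := by
      have := Nat.one_le_pow 2 n hn
      omega
    exact ⟨_, _, hdepth, refuter_PHP_one_reduction hn hd⟩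
  · rw [not_lt] at h2
    have hn6 : 6 ≤ n := by
      by_contra h
      have h5 : c ^ n ≤ c ^ 5 := pow_le_pow_right₀ hc1 (by omega)
      have : c ^ 5 < 2 := by norm_num [hc]
      linarith
    have hs2 : ⌊c ^ n⌋₊ ≤ 2 ^ n := by
      refine Nat.floor_le_of_le ?_
      push_cast
      exact pow_le_pow_left₀ (by positivity) (by norm_num [hc]) n
    have hs3 : ∀ t, n ≤ 2 * t → 2 * ⌊c ^ n⌋₊ * 65 ^ t ≤ 66 ^ t := by
      intro t ht
      have h4 : c ^ 4 * 65 ≤ 66 := by norm_num [hc]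
      have : (2 * ⌊c ^ n⌋₊ * 65 ^ t : ℝ) ≤ 66 ^ t := by
        calc (2 * ⌊c ^ n⌋₊ * 65 ^ t : ℝ) ≤ c ^ n * c ^ n * 65 ^ t := by gcongr
          _ = c ^ (2 * n) * 65 ^ t := by ring
          _ ≤ c ^ (4 * t) * 65 ^ t := by
            gcongr ?_ * _
            exact pow_le_pow_right₀ hc1 (by omega)
          _ = (c ^ 4 * 65) ^ t := by rw [mul_pow, pow_mul]
          _ ≤ 66 ^ t := pow_le_pow_left₀ (by positivity) h4 t
      exact_mod_cast this
    obtain ⟨j, hj⟩ := refuter_PHP_reduction hn6 hs1 hs2 hs3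
    exact ⟨j, _, hdepth, hj⟩
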